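/- \textbf{Setting.} Let $G=\langle \mathbf V,\mathbf E\rangle$ be a finite directed graph (cycles allowed) and let $k\ge 1$. Directed paths need not be self-avoiding and may have length $0$. A \emph{recursively additive model} on $G$ consists of real random variables $(X_v)_{v\in\mathbf V}$, jointly independent noises $(\epsilon_v)_{v\in\mathbf V}$, coefficients $a_{uv}\in\mathbb R$ and functions $f_{uv}:\mathbb R\to\mathbb R$ with $$X_v=\sum_{u\in \mathrm{Pa}(v)}a_{uv}f_{uv}(X_u)+\epsilon_v\quad\text{a.s. for all } v,$$ such that each $f_{uv}$ ($u\to v$ an edge) preserves additivity: writing $\mathrm{An}(u)$ for the set of vertices with a directed path to $u$ (including $u$), there are measurable $\varphi_w,g_w:\mathbb R\to\mathbb R$ ($w\in \mathrm{An}(u)$) with, almost surely, $X_u=\sum_{w\in \mathrm{An}(u)}\varphi_w(\epsilon_w)$ and $f_{uv}\bigl(\sum_{w}\varphi_w(\epsilon_w)\bigr)=\sum_{w}g_w(\varphi_w(\epsilon_w))$. All $X_v$ are assumed to have finite absolute moments of order $k$. A \emph{$k$-trek} between $v_1,\dots,v_k$ is a tuple $(\pi_1,\dots,\pi_k)$ of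 directed paths with a common first vertex, $\pi_j$ ending at $v_j$. Sets $(\mathbf A_1,\dots,\mathbf A_k)$ \emph{$k$-trek-separate} $(\mathbf S_1,\dots,\mathbf S_k)$ if for every $k$-trek $(\pi_1,\dots,\pi_k)$ between vertices $v_j\in\mathbf S_j$ some $\pi_j$ contains a vertex of $\mathbf A_j$. The model is \emph{linear under $\mathbf A_1,\dots,\mathbf A_k$ for $\mathbf S_1,\dots,\mathbf S_k$}, with coefficient matrix $L$, if for every edge $u\to v$ lying, for some $j$, on a directed path from a vertex of $\mathbf A_j$ to a vertex of $\mathbf S_j$, one has $a_{uv}f_{uv}(X_u)=L_{uv}X_u+d_{uv}$ a.s. with a constant $d_{uv}$, while $L_{uv}=0$ for all other pairs. For an order-$k$ tensor $T$ of format $n\times\cdots\times n$ the \emph{combinatorial hyperdeterminant} is $$\det T=\sum_{\sigma_2,\dots,\sigma_k\in\mathfrak S_n}\mathrm{sign}(\sigma_2)\cdots\mathrm{sign}(\sigma_k)\prod_{i=1}^nT_{i,\sigma_2(i),\dots,\sigma_k(i)} .$$ \textbf{Theorem.} Let $\mathbf S_1,\dots,\mathbf S_k\subset\mathbf V$ each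 have $n$ elements, and let $\mathbf A_1,\dots,\mathbf A_k\subset\mathbf V$ $k$-trek-separate them, the model being linear under $\mathbf A_1,\dots,\mathbf A_k$ for $\mathbf S_1,\dots,\mathbf S_k$ with a coefficient matrix $L$ such that $I-L$ is invertible (automatic if $G$ is acyclic). Assume that $k$ is even, or that $\mathbf A_1=\emptyset$ (the axis on which no permutation acts carries no choke vertices). If $\sum_{i=1}^k|\mathbf A_i|<n$, then for every ordering of the sets $\mathbf S_j$ the tensor $\mathcal C^{(k)}_{\mathbf S_1,\dots,\mathbf S_k}=\bigl(\mathrm{cum}(X_{s_1},\dots,X_{s_k})\bigr)_{s_j\in\mathbf S_j}$ of $k$-th order joint cumulants satisfies $\det\mathcal C^{(k)}_{\mathbf S_1,\dots,\mathbf S_k}=0$. -/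

import Mathlib

open MeasureTheory ProbabilityTheory

noncomputable section

/-- `l` is a directed path (not necessarily self-avoiding, possibly of length zero) from `u` to `v`
in the directed graph `G`, given by its list of vertices. -/
def IsDiPath {V : Type*} (G : Digraph V) (l : List V) (u v : V) : Prop :=
  l.IsChain G.Adj ∧ l.head? = some u ∧ l.getLast? = some v

open Classical in
/-- The vertices from which there is a directed path to `v`; in particular `v` itself. -/
def ancestors {V : Type*} [Fintype V] (G : Digraph V) (v : V) : Finset V :=
  Finset.univ.filter fun w => ∃ l, IsDiPath G l w v

open Classical in
/-- The parents of `v`. -/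
def parents {V : Type*} [Fintype V] (G : Digraph V) (v : V) : Finset V :=
  Finset.univ.filter fun u => G.Adj u v

/-- `π` is a `k`-trek between `v 0, …, v (k-1)` with top `t`. -/
def IsKTrek {V : Type*} (G : Digraph V) {k : ℕ} (t : V) (v : Fin k → V) (π : Fin k → List V) :
    Prop :=
  ∀ j, IsDiPath G (π j) t (v j)

/-- `(A j)` `k`-trek-separates `(S j)`. -/
def KTrekSeparates {V : Type*} (G : Digraph V) {k : ℕ} (A S : Fin k → Finset V) : Prop :=
  ∀ (t : V) (v : Fin k → V) (π : Fin k → List V), (∀ j, v j ∈ S j) → IsKTrek G t v π →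
    ∃ j, ∃ a ∈ π j, a ∈ A j

/-- The edge `u → v` lies on a directed path from some vertex of `A j` to some vertex of `S j`,
for some `j`. -/
def IsEdgeUnder {V : Type*} (G : Digraph V) {k : ℕ} (A S : Fin k → Finset V) (u v : V) : Prop :=
  ∃ j, ∃ a ∈ A j, ∃ s ∈ S j, ∃ l, IsDiPath G l a s ∧ [u, v] <:+: l

/-- `W` preserves the additivity of the sum of the random variables `p i`, `i ∈ s`:
`W (∑ i, p i) = ∑ i, w i (p i)` almost surely, for some functions `w i` of one real variable. -/
def PreservesAdditivity {Ω ι : Type*} [MeasurableSpace Ω] (μ : Measure Ω) (W : ℝ → ℝ)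
    (s : Finset ι) (p : ι → Ω → ℝ) : Prop :=
  ∃ w : ι → ℝ → ℝ, (∀ i, Measurable (w i)) ∧
    ∀ᵐ ω ∂μ, W (∑ i ∈ s, p i ω) = ∑ i ∈ s, w i (p i ω)

/-- A recursively additive model on the directed graph `G`: the noises are jointly independent,
every variable is a linear combination of functions of its parents plus its noise, and each of these
functions preserves the additivity of its argument, where a variable is split into a sum of terms
each of which depends on the noise of a single ancestor. -/
structure RecursivelyAdditiveModel {V Ω : Type*} [Fintype V] [MeasurableSpace Ω]
    (G : Digraph V) (μ : Measure Ω) where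
  X : V → Ω → ℝ
  noise : V → Ω → ℝ
  coef : V → V → ℝ
  f : V → V → ℝ → ℝ
  measurable_noise : ∀ v, Measurable (noise v)
  indep_noise : iIndepFun noise μ
  structural_eq : ∀ v, ∀ᵐ ω ∂μ,
    X v ω = ∑ u ∈ parents G v, coef u v * f u v (X u ω) + noise v ω
  additive : ∀ u v, G.Adj u v → ∃ φ : V → ℝ → ℝ, (∀ w, Measurable (φ w)) ∧
    (∀ᵐ ω ∂μ, X u ω = ∑ w ∈ ancestors G u, φ w (noise w ω)) ∧
    PreservesAdditivity μ (f u v) (ancestors G u) fun w ω => φ w (noise w ω)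

/-- The model is linear under `(A j)` for `(S j)` with coefficient matrix `L`: every edge on a
directed path from `A j` to `S j` acts linearly, up to an additive constant (which may be counted to
the noise), and `L` collects the coefficients of exactly these edges. -/
structure IsLinearUnder {V Ω : Type*} [Fintype V] [MeasurableSpace Ω]
    {G : Digraph V} {μ : Measure Ω} (M : RecursivelyAdditiveModel G μ) {k : ℕ}
    (A S : Fin k → Finset V) (L : Matrix V V ℝ) : Prop where
  linear : ∀ u v, IsEdgeUnder G A S u v →
    ∃ d : ℝ, ∀ᵐ ω ∂μ, M.coef u v * M.f u v (M.X u ω) = L u v * M.X u ω + d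
  zero : ∀ u v, ¬ IsEdgeUnder G A S u v → L u v = 0

/-- The joint cumulant of `Z 0, …, Z (k-1)`, as a sum over all partitions of the index set. -/
def jointCumulant {Ω : Type*} [MeasurableSpace Ω] (μ : Measure Ω) {k : ℕ}
    (Z : Fin k → Ω → ℝ) : ℝ :=
  ∑ P : Finpartition (Finset.univ : Finset (Fin k)),
    (-1 : ℝ) ^ (P.parts.card - 1) * ((P.parts.card - 1).factorial : ℝ) *
      ∏ B ∈ P.parts, ∫ ω, ∏ j ∈ B, Z j ω ∂μ

/-- The combinatorial hyperdeterminant of an `n × ⋯ × n` tensor of order `k ≥ 1`; the first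
of the `k` permutations is the identity. -/
def combinatorialHyperdet {k n : ℕ} [NeZero k] (T : (Fin k → Fin n) → ℝ) : ℝ :=
  ∑ σ : Fin k → Equiv.Perm (Fin n) with σ 0 = 1,
    (∏ j, ((Equiv.Perm.sign (σ j) : ℤ) : ℝ)) * ∏ i, T fun j => σ j i

end

/-! For each axis `j` let `B j` be the set of vertices with a directed path to `S j` avoiding `A j`.
All parents of a vertex of `B j` lie in `A j ∪ B j`. If `v ∈ B j` and the edge `u → v` is not
required to be linear, then no ancestor of `u` lies in `A j`, so all of them lie in `B j`, and
additivity turns `f u v (X u)` into a sum of functions of single noises from `B j`. Hence the column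
of `1 - L` at `v` is a linear relation between the variables of `A j ∪ B j` modulo such noise sums
(`IsLinearUnder.sum_mem_noiseSums`).

As `1 - L` is invertible, these `|B j|` relations are independent, so modulo noise sums the
variables of `A j ∪ B j` span at most `|A j|` dimensions (`exists_linear_combination_of_isUnit`).
Every `X s` with `s ∈ S j` is thus a combination of at most `|A j|` fixed variables `Z j r` plus a
noise sum over `B j`.

Trek separation says that no vertex lies in all the `B j`, so the joint cumulant of the noise sums
vanishes (`jointCumulant_eq_zero_of_noiseSums`). Telescoping by multilinearity leaves at most `∑ |A
j| < n` tensors, each a function of one index times a function of the others. The hyperdeterminant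
of such a sum is zero by a pigeonhole argument and a sign-reversing involution
(`combinatorialHyperdet_eq_zero_of_slices`). -/

/-! ### Hyperdeterminants of tensors of small slice rank. -/

section Hyperdeterminant

/-- The signed term of the combinatorial hyperdeterminant for a tuple of permutations. -/
noncomputable def hyperdetTerm {k n : ℕ} (T : (Fin k → Fin n) → ℝ)
    (σ : Fin k → Equiv.Perm (Fin n)) : ℝ :=
  (∏ j, ((Equiv.Perm.sign (σ j) : ℤ) : ℝ)) * ∏ i, T fun j => σ j i

/-- Right multiplication by `τ` only reorders the product over `i`, and the signs change by `sign τ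
^ k`, which is where even order is needed. -/
theorem hyperdetTerm_mul_const {k n : ℕ} (hk : Even k) (T : (Fin k → Fin n) → ℝ)
    (σ : Fin k → Equiv.Perm (Fin n)) (τ : Equiv.Perm (Fin n)) :
    hyperdetTerm T (fun j => σ j * τ) = hyperdetTerm T σ := by
  unfold hyperdetTerm
  congr 1
  · simp only [Equiv.Perm.sign_mul, Units.val_mul, Int.cast_mul, Finset.prod_mul_distrib,
      Finset.prod_const, Finset.card_univ, Fintype.card_fin]
    have h : (((Equiv.Perm.sign τ : ℤ) : ℝ)) ^ k = 1 := by
      rcases Int.units_eq_one_or (Equiv.Perm.sign τ) with h | h <;> simp [h, hk.neg_one_pow]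
    rw [h, mul_one]
  · exact Equiv.prod_comp τ fun i => T fun j => σ j i

/-- For even order, the hyperdeterminant can be computed by letting all permutations vary. -/
theorem sum_hyperdetTerm_of_even {k n : ℕ} [NeZero k] (hk : Even k) (T : (Fin k → Fin n) → ℝ) :
    ∑ σ, hyperdetTerm T σ = (n.factorial : ℝ) * combinatorialHyperdet T := by
  classical
  rw [← Finset.sum_fiberwise (Finset.univ : Finset (Fin k → Equiv.Perm (Fin n))) (fun σ => σ 0)]
  have h (τ : Equiv.Perm (Fin n)) :
      ∑ σ : Fin k → Equiv.Perm (Fin n) with σ 0 = τ, hyperdetTerm T σ =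
        combinatorialHyperdet T := by
    refine Finset.sum_nbij' (fun σ j => σ j * τ⁻¹) (fun σ j => σ j * τ) ?_ ?_ ?_ ?_ ?_
    · intro σ hσ
      simp only [Finset.mem_filter, Finset.mem_univ, true_and] at hσ ⊢
      rw [hσ, mul_inv_cancel]
    · intro σ hσ
      simp only [Finset.mem_filter, Finset.mem_univ, true_and] at hσ ⊢
      rw [hσ, one_mul]
    · intro σ _
      simp
    · intro σ _
      simp
    · intro σ _
      exact (hyperdetTerm_mul_const hk T σ τ⁻¹).symm
  simp [h, Fintype.card_perm]

/-- The signed sum over a family of tuples of permutations which is closed under changing the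
permutations on the axes `ax ρ` vanishes if the tensor is a sum of fewer than `n` slice rank one
tensors along these axes. -/
theorem sum_hyperdetTerm_eq_zero {k n : ℕ} {ι : Type*} [Fintype ι] (hι : Fintype.card ι < n)
    (ax : ι → Fin k) (c : ι → Fin n → ℝ) (U : ι → (Fin k → Fin n) → ℝ)
    (hU : ∀ ρ i x, U ρ (Function.update i (ax ρ) x) = U ρ i)
    (F : Finset (Fin k → Equiv.Perm (Fin n)))
    (hF : ∀ σ ∈ F, ∀ ρ τ, Function.update σ (ax ρ) (σ (ax ρ) * τ) ∈ F) :
    ∑ σ ∈ F, hyperdetTerm (fun i => ∑ ρ, c ρ (i (ax ρ)) * U ρ i) σ = 0 := by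
  classical
  simp only [hyperdetTerm, Finset.prod_univ_sum, Finset.mul_sum, Fintype.piFinset_univ]
  rw [Finset.sum_comm]
  -- `r` records which slice term is chosen in each row `i`. With fewer than `n` terms, two rows `a`
  -- and `b` choose the same one; exchanging their values on its axis reverses the sign.
  refine Finset.sum_eq_zero fun r _ => ?_
  obtain ⟨a, b, hab, hr⟩ := Fintype.exists_ne_map_eq_of_card_lt r (by simpa using hι)
  have hsign (σ : Fin k → Equiv.Perm (Fin n)) :
      (∏ j, ((Equiv.Perm.sign (Function.update σ (ax (r a)) (σ (ax (r a)) * Equiv.swap a b) j) :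
        ℤ) : ℝ)) = -∏ j, ((Equiv.Perm.sign (σ j) : ℤ) : ℝ) := by
    rw [← Finset.mul_prod_erase _ _ (Finset.mem_univ (ax (r a))),
      ← Finset.mul_prod_erase _ (fun j => ((Equiv.Perm.sign (σ j) : ℤ) : ℝ))
        (Finset.mem_univ (ax (r a)))]
    simp only [Function.update_self, Equiv.Perm.sign_mul, Equiv.Perm.sign_swap hab]
    rw [Finset.prod_congr rfl fun j hj => by
      rw [Function.update_of_ne (Finset.ne_of_mem_erase hj)]]
    simp
  have hprod (σ : Fin k → Equiv.Perm (Fin n)) :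
      ∏ i, (c (r i) (Function.update σ (ax (r a)) (σ (ax (r a)) * Equiv.swap a b) (ax (r i)) i) *
        U (r i) fun j => Function.update σ (ax (r a)) (σ (ax (r a)) * Equiv.swap a b) j i) =
      ∏ i, (c (r i) (σ (ax (r i)) i) * U (r i) fun j => σ j i) := by
    have hfun (i : Fin n) :
        (fun j => Function.update σ (ax (r a)) (σ (ax (r a)) * Equiv.swap a b) j i) =
          Function.update (fun j => σ j i) (ax (r a)) (σ (ax (r a)) (Equiv.swap a b i)) := by
      funext j
      rcases eq_or_ne j (ax (r a)) with rfl | hj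
      · simp
      · simp [hj]
    have hne (i : Fin n) (hia : i ≠ a) (hib : i ≠ b) :
        (fun j => Function.update σ (ax (r a)) (σ (ax (r a)) * Equiv.swap a b) j i) =
          fun j => σ j i := by
      rw [hfun, Equiv.swap_apply_of_ne_of_ne hia hib, Function.update_eq_self]
    have hUi (i : Fin n) :
        (U (r i) fun j => Function.update σ (ax (r a)) (σ (ax (r a)) * Equiv.swap a b) j i) =
          U (r i) fun j => σ j i := by
      rcases eq_or_ne i a with rfl | hia
      · rw [hfun, hU]
      rcases eq_or_ne i b with rfl | hib
      · rw [hfun, hr, hU]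
      · rw [hne i hia hib]
    -- The `U` factors do not see the exchange, and the `c` factors of rows `a` and `b` trade places
    -- because `r a = r b`.
    simp only [hUi, Finset.prod_mul_distrib]
    congr 1
    refine Fintype.prod_equiv (Equiv.swap a b) _ _ fun i => ?_
    rcases eq_or_ne i a with rfl | hia
    · simp [hr]
    rcases eq_or_ne i b with rfl | hib
    · simp [hr]
    · rw [Equiv.swap_apply_of_ne_of_ne hia hib]
      exact congrArg _ (congrFun (hne i hia hib) (ax (r i)))
  refine Finset.sum_involution
    (fun σ _ => Function.update σ (ax (r a)) (σ (ax (r a)) * Equiv.swap a b)) ?_ ?_ ?_ ?_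
  · intro σ _
    rw [hsign, hprod]
    ring
  · intro σ _ _ h
    have h1 := congrFun h (ax (r a))
    rw [Function.update_self, mul_eq_left] at h1
    exact hab (Equiv.swap_eq_one_iff.mp h1)
  · intro σ hσ
    exact hF σ hσ _ _
  · intro σ _
    simp [mul_assoc]

/-- A tensor which is a sum of fewer than `n` slice rank one tensors has vanishing combinatorial
hyperdeterminant, if its order is even or no slices are taken along the distinguished axis. -/
theorem combinatorialHyperdet_eq_zero_of_slices {k n : ℕ} [NeZero k] {ι : Type*} [Fintype ι]
    (hι : Fintype.card ι < n) (ax : ι → Fin k) (hax : Even k ∨ ∀ ρ, ax ρ ≠ 0)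
    (c : ι → Fin n → ℝ) (U : ι → (Fin k → Fin n) → ℝ)
    (hU : ∀ ρ i x, U ρ (Function.update i (ax ρ) x) = U ρ i) :
    combinatorialHyperdet (fun i => ∑ ρ, c ρ (i (ax ρ)) * U ρ i) = 0 := by
  rcases hax with hk | hax
  · have h := sum_hyperdetTerm_of_even hk fun i => ∑ ρ, c ρ (i (ax ρ)) * U ρ i
    rw [sum_hyperdetTerm_eq_zero hι ax c U hU Finset.univ fun _ _ _ _ => Finset.mem_univ _] at h
    exact (mul_eq_zero.mp h.symm).resolve_left (by exact_mod_cast n.factorial_ne_zero)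
  · refine sum_hyperdetTerm_eq_zero hι ax c U hU _ fun σ hσ ρ τ => ?_
    simp only [Finset.mem_filter, Finset.mem_univ, true_and] at hσ ⊢
    rw [Function.update_of_ne (hax ρ).symm, hσ]

end Hyperdeterminant

/-! ### Moments and cumulants as functions of finite sets. -/

section CumulantCombinatorics

variable {α : Type*} [DecidableEq α]

/-- The coefficient of a partition with `q` blocks in the formula for cumulants by moments. -/
def cumulantWeight (q : ℕ) : ℝ := (-1) ^ (q - 1) * ((q - 1).factorial : ℝ)

theorem cumulantWeight_add_mul {q : ℕ} (hq : 1 ≤ q) :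
    cumulantWeight q + ((q - 1 : ℕ) : ℝ) * cumulantWeight (q - 1) = if q = 1 then 1 else 0 := by
  unfold cumulantWeight
  obtain ⟨p, rfl⟩ := Nat.exists_eq_add_of_le' hq
  rcases p with _ | p
  · simp
  · simp [Nat.factorial_succ, pow_succ]
    ring

/-- The cumulants belonging to a family of moments indexed by finite sets. -/
noncomputable def setCumulant (m : Finset α → ℝ) (S : Finset α) : ℝ :=
  ∑ P : Finpartition S, cumulantWeight P.parts.card * ∏ B ∈ P.parts, m B

theorem Finpartition.sigma_ext {x y : Σ S : Finset α, Finpartition S} (h : x.1 = y.1)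
    (hp : x.2.parts = y.2.parts) : x = y := by
  obtain ⟨S, P⟩ := x
  obtain ⟨S', P'⟩ := y
  obtain rfl : S = S' := h
  exact congrArg _ (Finpartition.ext hp)

theorem Finpartition.card_filter_notMem {S : Finset α} (P : Finpartition S) {a : α} (ha : a ∈ S) :
    (P.parts.filter (a ∉ ·)).card = P.parts.card - 1 := by
  have h : P.parts.filter (a ∉ ·) = P.parts.erase (P.part a) := by
    ext C
    simp only [Finset.mem_filter, Finset.mem_erase]
    constructor
    · rintro ⟨hC, haC⟩
      refine ⟨?_, hC⟩
      rintro rfl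
      exact haC (P.mem_part_self.mpr ha)
    · rintro ⟨hne, hC⟩
      exact ⟨hC, fun haC => hne (P.part_eq_of_mem hC haC).symm⟩
  rw [h, Finset.card_erase_of_mem (P.part_mem.mpr ha)]

/-- Adjoining the block `S \ B` to a partition of `B` gives a partition `Q` of `S` with a marked
block missing `a`. Each `Q` has one fewer such block than blocks in all, whence the factor. -/
theorem sum_ssubsets_finpartition (m : Finset α → ℝ) {S : Finset α} {a : α} (ha : a ∈ S) :
    ∑ B ∈ S.ssubsets with a ∈ B, setCumulant m B * m (S \ B) =
      ∑ Q : Finpartition S, ((Q.parts.card - 1 : ℕ) : ℝ) * cumulantWeight (Q.parts.card - 1) *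
        ∏ B ∈ Q.parts, m B := by
  have hQ (Q : Finpartition S) :
      ((Q.parts.card - 1 : ℕ) : ℝ) * cumulantWeight (Q.parts.card - 1) * ∏ B ∈ Q.parts, m B =
        ∑ _C ∈ Q.parts.filter (a ∉ ·), cumulantWeight (Q.parts.card - 1) * ∏ B ∈ Q.parts, m B := by
    rw [Finset.sum_const, Q.card_filter_notMem ha, nsmul_eq_mul, mul_assoc]
  simp only [hQ, setCumulant, Finset.sum_mul]
  rw [Finset.sum_sigma', Finset.sum_sigma']
  have hmem : ∀ x ∈ (S.ssubsets.filter (a ∈ ·)).sigma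
      (fun B => (Finset.univ : Finset (Finpartition B))), x.1 ⊂ S ∧ a ∈ x.1 := by
    intro x hx
    simpa using hx
  have hnotMem (x : Σ B : Finset α, Finpartition B) : S \ x.1 ∉ x.2.parts ∨ S \ x.1 = ∅ := by
    by_contra! h
    obtain ⟨y, hy⟩ := h.2
    exact (Finset.mem_sdiff.mp hy).2 (x.2.subset h.1 hy)
  have hne : ∀ x ∈ (S.ssubsets.filter (a ∈ ·)).sigma
      (fun B => (Finset.univ : Finset (Finpartition B))), S \ x.1 ≠ ∅ := fun x hx =>
    (Finset.sdiff_nonempty.mpr (hmem x hx).1.2).ne_empty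
  refine Finset.sum_bij
    (fun x hx => ⟨x.2.extend (hne x hx) Finset.disjoint_sdiff
      (Finset.union_sdiff_of_subset (hmem x hx).1.1), S \ x.1⟩) ?_ ?_ ?_ ?_
  · intro x hx
    simp [(hmem x hx).2]
  · intro x hx y hy hxy
    obtain ⟨h1, h2⟩ := Sigma.mk.inj hxy
    have h2 := eq_of_heq h2
    have h1 := congrArg Finpartition.parts h1
    simp only [Finpartition.extend_parts] at h1
    refine Finpartition.sigma_ext ?_ ?_
    · rw [← Finset.sdiff_sdiff_eq_self (hmem x hx).1.1, h2,
        Finset.sdiff_sdiff_eq_self (hmem y hy).1.1]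
    · rw [← Finset.erase_insert ((hnotMem x).resolve_right (hne x hx)), h1, h2,
        Finset.erase_insert ((hnotMem y).resolve_right (hne y hy))]
  · rintro ⟨Q, C⟩ hx
    simp only [Finset.mem_sigma, Finset.mem_univ, Finset.mem_filter, true_and] at hx
    obtain ⟨hC, haC⟩ := hx
    have hsup : (Q.parts.erase C).sup id = S \ C := by
      ext y
      simp only [Finset.mem_sup, Finset.mem_erase, id, Finset.mem_sdiff]
      constructor
      · rintro ⟨B, ⟨hBC, hB⟩, hy⟩
        exact ⟨Q.subset hB hy, fun hyC => hBC (Q.eq_of_mem_parts hB hC hy hyC)⟩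
      · rintro ⟨hy, hyC⟩
        obtain ⟨B, hB, hyB⟩ := Q.exists_mem hy
        exact ⟨B, ⟨fun h => hyC (h ▸ hyB), hB⟩, hyB⟩
    have hdd : S \ (S \ C) = C := Finset.sdiff_sdiff_eq_self (Q.subset hC)
    refine ⟨⟨S \ C, Q.ofSubset (Finset.erase_subset C Q.parts) hsup⟩, ?_, ?_⟩
    · simp only [Finset.mem_sigma, Finset.mem_filter, Finset.mem_ssubsets, Finset.mem_univ,
        and_true, Finset.mem_sdiff]
      exact ⟨Finset.sdiff_ssubset (Q.subset hC) (Q.nonempty_of_mem_parts hC), ha, haC⟩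
    · refine Sigma.ext (Finpartition.ext ?_) (heq_of_eq hdd)
      simp only [Finpartition.extend_parts, Finpartition.ofSubset_parts, hdd]
      exact Finset.insert_erase hC
  · intro x hx
    have h := (hnotMem x).resolve_right (hne x hx)
    simp only [Finpartition.extend_parts]
    rw [Finset.card_insert_of_notMem h, Finset.prod_insert h, Nat.add_sub_cancel]
    ring

/-- The recursion between moments and cumulants. -/
theorem sum_setCumulant_mul (m : Finset α → ℝ) (hm : m ∅ = 1) {S : Finset α} {a : α}
    (ha : a ∈ S) : ∑ B ∈ S.powerset with a ∈ B, setCumulant m B * m (S \ B) = m S := by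
  have hS : S.powerset.filter (a ∈ ·) = insert S (S.ssubsets.filter (a ∈ ·)) := by
    ext B
    simp only [Finset.mem_filter, Finset.mem_powerset, Finset.mem_insert, Finset.mem_ssubsets,
      Finset.ssubset_iff_subset_ne]
    constructor
    · rintro ⟨h1, h2⟩
      by_cases h : B = S
      · exact Or.inl h
      · exact Or.inr ⟨⟨h1, h⟩, h2⟩
    · rintro (rfl | ⟨⟨h1, -⟩, h2⟩)
      · exact ⟨subset_rfl, ha⟩
      · exact ⟨h1, h2⟩
  have hcard (Q : Finpartition S) : 1 ≤ Q.parts.card :=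
    Finset.card_pos.mpr (Q.parts_nonempty (Finset.ne_empty_of_mem ha))
  rw [hS, Finset.sum_insert (by simp), sum_ssubsets_finpartition m ha, Finset.sdiff_self, hm,
    mul_one, setCumulant, ← Finset.sum_add_distrib]
  simp only [← add_mul]
  -- The weights cancel for every partition with at least two blocks; only the one-block partition
  -- survives.
  rw [Finset.sum_congr rfl fun Q _ => by rw [cumulantWeight_add_mul (hcard Q)]]
  rw [Finset.sum_eq_single (Finpartition.indiscrete (Finset.ne_empty_of_mem ha))]
  · simp
  · intro Q _ hQ
    rw [if_neg, zero_mul]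
    intro h
    obtain ⟨C, hC⟩ := Finset.card_eq_one.mp h
    refine hQ (Finpartition.ext ?_)
    have := Q.biUnion_parts
    rw [hC, Finset.singleton_biUnion, id] at this
    rw [hC, this]
    rfl
  · simp

/-- If the moments factor along a splitting of the index set, the mixed cumulants vanish. -/
theorem setCumulant_eq_zero (m : Finset α → ℝ) (hm : m ∅ = 1) (I : Finset α)
    (hI : ∀ S, m S = m (S ∩ I) * m (S \ I)) (S : Finset α) (h1 : (S ∩ I).Nonempty)
    (h2 : (S \ I).Nonempty) : setCumulant m S = 0 := by
  induction S using Finset.strongInduction with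
  | H S ih =>
    obtain ⟨a, haSI⟩ := h1
    obtain ⟨ha, haI⟩ := Finset.mem_inter.mp haSI
    obtain ⟨b, hbS⟩ := h2
    obtain ⟨hb, hbI⟩ := Finset.mem_sdiff.mp hbS
    have hrec := sum_setCumulant_mul m hm ha
    have hrecI := sum_setCumulant_mul m hm haSI
    rw [← Finset.sum_filter_add_sum_filter_not _ (fun B => B ⊆ I)] at hrec
    -- The blocks inside `I` already account for all of `m S`, by the recursion for `S ∩ I` times `m
    -- (S \ I)`. The other blocks thus contribute zero in total, and by induction only `B = S` can
    -- be nonzero among them.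
    have hin : ∑ B ∈ (S.powerset.filter (a ∈ ·)).filter (fun B => B ⊆ I),
        setCumulant m B * m (S \ B) = m S := by
      have hset : (S.powerset.filter (a ∈ ·)).filter (fun B => B ⊆ I) =
          (S ∩ I).powerset.filter (a ∈ ·) := by
        ext B
        simp only [Finset.mem_filter, Finset.mem_powerset, Finset.subset_inter_iff]
        tauto
      rw [hset, hI S, ← hrecI, Finset.sum_mul]
      refine Finset.sum_congr rfl fun B hB => ?_
      simp only [Finset.mem_filter, Finset.mem_powerset, Finset.subset_inter_iff] at hB
      rw [hI (S \ B), mul_assoc]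
      congr 3
      · ext x; simp only [Finset.mem_inter, Finset.mem_sdiff]; tauto
      · ext x
        have := @hB.1.2 x
        simp only [Finset.mem_sdiff]; tauto
    rw [hin, add_eq_left] at hrec
    rw [Finset.sum_eq_single_of_mem S] at hrec
    · simpa [hm] using hrec
    · simp only [Finset.mem_filter, Finset.mem_powerset, subset_refl, ha, true_and]
      exact fun h => hbI (h hb)
    · intro B hB hne
      simp only [Finset.mem_filter, Finset.mem_powerset] at hB
      rw [ih B (Finset.ssubset_iff_subset_ne.mpr ⟨hB.1.1, hne⟩)
        ⟨a, Finset.mem_inter.mpr ⟨hB.1.2, haI⟩⟩ (Finset.sdiff_nonempty.mpr hB.2), zero_mul]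

end CumulantCombinatorics

/-! ### Multilinearity of the joint cumulant. -/

section JointCumulant

variable {Ω : Type*} [MeasurableSpace Ω] {μ : Measure Ω}

theorem jointCumulant_eq_setCumulant {k : ℕ} (Z : Fin k → Ω → ℝ) :
    jointCumulant μ Z = setCumulant (fun B => ∫ ω, ∏ j ∈ B, Z j ω ∂μ) Finset.univ := rfl

theorem jointCumulant_congr_ae {k : ℕ} {Z Z' : Fin k → Ω → ℝ} (h : ∀ j, Z j =ᵐ[μ] Z' j) :
    jointCumulant μ Z = jointCumulant μ Z' := by
  simp only [jointCumulant_eq_setCumulant]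
  congr 1
  funext B
  refine integral_congr_ae ?_
  filter_upwards [ae_all_iff.mpr h] with ω hω
  exact Finset.prod_congr rfl fun j _ => hω j

variable (μ) in
/-- The real functions with finite `p`-th absolute moment. -/
def memLpSubmodule (p : ENNReal) : Submodule ℝ (Ω → ℝ) where
  carrier := {f | MemLp f p μ}
  add_mem' hf hg := hf.add hg
  zero_mem' := MemLp.zero
  smul_mem' c _ hf := hf.const_smul c

/-- Hölder's inequality: at most `k` factors, each in `L^k`. -/
theorem integrable_prod_of_memLp [IsFiniteMeasure μ] {k : ℕ} {Z : Fin k → Ω → ℝ}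
    (hZ : ∀ j, MemLp (Z j) k μ) (B : Finset (Fin k)) :
    Integrable (fun ω => ∏ j ∈ B, Z j ω) μ := by
  refine (MemLp.prod' (s := B) fun j _ => hZ j).integrable ?_
  rw [Finset.sum_const, nsmul_eq_mul, ENNReal.one_le_inv, ← div_eq_mul_inv]
  refine ENNReal.div_le_of_le_mul ?_
  rw [one_mul]
  exact_mod_cast (Finset.card_le_univ B).trans_eq (Fintype.card_fin k)

theorem Finpartition.prod_parts_eq_mul {α M : Type*} [DecidableEq α] [CommMonoid M] {S : Finset α}
    (P : Finpartition S) {i : α} (hi : i ∈ S) (g : Finset α → M) :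
    ∏ B ∈ P.parts, g B = g (P.part i) * ∏ B ∈ P.parts.erase (P.part i), g B :=
  (Finset.mul_prod_erase _ _ (P.part_mem.mpr hi)).symm

/-- Slot `i` enters only through the moment of its own block, so linearity in this slot reduces to
linearity of one integral. -/
theorem prod_parts_integral_update {k : ℕ} (P : Finpartition (Finset.univ : Finset (Fin k)))
    (Z : Fin k → Ω → ℝ) (i : Fin k) (x : Ω → ℝ) :
    ∏ B ∈ P.parts, ∫ ω, ∏ j ∈ B, Function.update Z i x j ω ∂μ =
      (∫ ω, x ω * ∏ j ∈ (P.part i).erase i, Z j ω ∂μ) *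
        ∏ B ∈ P.parts.erase (P.part i), ∫ ω, ∏ j ∈ B, Z j ω ∂μ := by
  rw [P.prod_parts_eq_mul (Finset.mem_univ i)]
  congr 1
  · congr 1
    funext ω
    rw [← Finset.mul_prod_erase _ _ (P.mem_part_self.mpr (Finset.mem_univ i)),
      Function.update_self]
    congr 1
    refine Finset.prod_congr rfl fun j hj => ?_
    rw [Function.update_of_ne (Finset.ne_of_mem_erase hj)]
  · refine Finset.prod_congr rfl fun B hB => ?_
    congr 1
    funext ω
    refine Finset.prod_congr rfl fun j hj => ?_
    rw [Function.update_of_ne]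
    rintro rfl
    exact (Finset.mem_erase.mp hB).1
      (P.part_eq_of_mem (Finset.mem_of_mem_erase hB) hj).symm

theorem integrable_mul_prod_of_memLp [IsFiniteMeasure μ] {k : ℕ} {Z : Fin k → Ω → ℝ}
    (hZ : ∀ j, MemLp (Z j) k μ) {x : Ω → ℝ} (hx : MemLp x k μ) (B : Finset (Fin k)) {i : Fin k}
    (hi : i ∈ B) : Integrable (fun ω => x ω * ∏ j ∈ B.erase i, Z j ω) μ := by
  have h : ∀ j, MemLp (Function.update Z i x j) k μ := by
    intro j
    rcases eq_or_ne j i with rfl | hj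
    · simpa using hx
    · simpa [hj] using hZ j
  refine (integrable_prod_of_memLp h B).congr (Filter.Eventually.of_forall fun ω => ?_)
  simp only
  rw [← Finset.mul_prod_erase _ _ hi, Function.update_self]
  congr 1
  refine Finset.prod_congr rfl fun j hj => ?_
  rw [Function.update_of_ne (Finset.ne_of_mem_erase hj)]

variable (μ) in
/-- The joint cumulant as a multilinear map on the variables with finite `k`-th moments. -/
noncomputable def cumulantMultilinear [IsFiniteMeasure μ] (k : ℕ) :
    MultilinearMap ℝ (fun _ : Fin k => memLpSubmodule μ (k : ENNReal)) ℝ where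
  toFun Z := jointCumulant μ fun j => (Z j : Ω → ℝ)
  map_update_add' := by
    intro inst Z i x y
    obtain rfl : inst = instDecidableEqFin k := Subsingleton.elim _ _
    have hcoe (z : memLpSubmodule μ (k : ENNReal)) (j : Fin k) :
        (Function.update Z i z j : Ω → ℝ) =
          Function.update (fun j => (Z j : Ω → ℝ)) i z j := by
      rcases eq_or_ne j i with rfl | hj <;> simp [*]
    simp only [jointCumulant, hcoe]
    rw [← Finset.sum_add_distrib]
    refine Finset.sum_congr rfl fun P _ => ?_
    simp only [prod_parts_integral_update]
    have hi := P.mem_part_self.mpr (Finset.mem_univ i)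
    have hadd : ∫ ω, ((x + y : memLpSubmodule μ (k : ENNReal)) : Ω → ℝ) ω *
          ∏ j ∈ (P.part i).erase i, (Z j : Ω → ℝ) ω ∂μ =
        ∫ ω, (x : Ω → ℝ) ω * ∏ j ∈ (P.part i).erase i, (Z j : Ω → ℝ) ω ∂μ +
          ∫ ω, (y : Ω → ℝ) ω * ∏ j ∈ (P.part i).erase i, (Z j : Ω → ℝ) ω ∂μ := by
      rw [← integral_add
        (integrable_mul_prod_of_memLp (fun j => (Z j).2) x.2 _ hi)
        (integrable_mul_prod_of_memLp (fun j => (Z j).2) y.2 _ hi)]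
      simp [add_mul]
    rw [hadd]
    ring
  map_update_smul' := by
    intro inst Z i c x
    obtain rfl : inst = instDecidableEqFin k := Subsingleton.elim _ _
    have hcoe (z : memLpSubmodule μ (k : ENNReal)) (j : Fin k) :
        (Function.update Z i z j : Ω → ℝ) =
          Function.update (fun j => (Z j : Ω → ℝ)) i z j := by
      rcases eq_or_ne j i with rfl | hj <;> simp [*]
    simp only [jointCumulant, hcoe]
    rw [smul_eq_mul, Finset.mul_sum]
    refine Finset.sum_congr rfl fun P _ => ?_
    simp only [prod_parts_integral_update]
    have hsmul : ∫ ω, ((c • x : memLpSubmodule μ (k : ENNReal)) : Ω → ℝ) ω *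
          ∏ j ∈ (P.part i).erase i, (Z j : Ω → ℝ) ω ∂μ =
        c * ∫ ω, (x : Ω → ℝ) ω * ∏ j ∈ (P.part i).erase i, (Z j : Ω → ℝ) ω ∂μ := by
      rw [← integral_const_mul]
      simp [mul_assoc]
    rw [hsmul]
    ring

end JointCumulant

/-! ### Vanishing of cumulants by independence. -/

section Independence

variable {Ω : Type*} [MeasurableSpace Ω] {μ : Measure Ω}

/-- A summand of a sum of two independent variables inherits the finite moments of the sum. -/
theorem IndepFun.memLp_left_of_memLp_add [IsProbabilityMeasure μ] {X Y : Ω → ℝ} {p : ℕ}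
    (hp : p ≠ 0) (h : IndepFun X Y μ) (hX : Measurable X) (hY : Measurable Y)
    (hXY : MemLp (fun ω => X ω + Y ω) p μ) : MemLp X p μ := by
  have hmap := (indepFun_iff_map_prod_eq_prod_map_map hX.aemeasurable hY.aemeasurable).mp h
  have : IsProbabilityMeasure (μ.map X) := Measure.isProbabilityMeasure_map hX.aemeasurable
  have : IsProbabilityMeasure (μ.map Y) := Measure.isProbabilityMeasure_map hY.aemeasurable
  have hadd : Measurable fun z : ℝ × ℝ => z.1 + z.2 := by fun_prop
  have h1 : MemLp (fun z : ℝ × ℝ => z.1 + z.2) p ((μ.map X).prod (μ.map Y)) := by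
    rw [← hmap, memLp_map_measure_iff hadd.aestronglyMeasurable (hX.prodMk hY).aemeasurable]
    exact hXY
  -- By Fubini some translate `x + y` with fixed `y` has finite moments under the law of `X`; the
  -- constant is then subtracted.
  obtain ⟨y, hy⟩ := (h1.integrable_norm_rpow'.prod_left_ae).exists
  have h2 : MemLp (fun x : ℝ => x + y) p (μ.map X) :=
    (integrable_norm_rpow_iff (by fun_prop) (by exact_mod_cast hp) (ENNReal.natCast_ne_top p)).mp hy
  have h3 : MemLp (fun x : ℝ => x) p (μ.map X) := by
    exact (h2.sub (memLp_const y)).congr_norm (by fun_prop)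
      (Filter.Eventually.of_forall fun x => by simp)
  exact (memLp_map_measure_iff (by fun_prop) hX.aemeasurable).mp h3

variable {V : Type*} {noise : V → Ω → ℝ}

theorem memLp_summand_of_memLp_sum [IsProbabilityMeasure μ] (hm : ∀ v, Measurable (noise v))
    (hind : iIndepFun noise μ) {ψ : V → ℝ → ℝ} (hψ : ∀ v, Measurable (ψ v)) {B : Finset V}
    {p : ℕ} (hp : p ≠ 0) (h : MemLp (fun ω => ∑ t ∈ B, ψ t (noise t ω)) p μ) {t : V}
    (ht : t ∈ B) : MemLp (fun ω => ψ t (noise t ω)) p μ := by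
  classical
  have hmeas (v : V) : Measurable (ψ v ∘ noise v) := (hψ v).comp (hm v)
  have h1 := (hind.comp ψ hψ).indepFun_finsetSum_of_notMem hmeas (Finset.notMem_erase t B)
  have hsum : Measurable (∑ v ∈ B.erase t, ψ v ∘ noise v) := by
    rw [Finset.sum_fn]
    exact Finset.measurable_sum _ fun v _ => hmeas v
  refine IndepFun.memLp_left_of_memLp_add (X := ψ t ∘ noise t) hp h1.symm (hmeas t)
    hsum ?_
  refine h.congr_norm ?_ (Filter.Eventually.of_forall fun ω => ?_)
  · exact ((hmeas t).add hsum).aestronglyMeasurable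
  · simp only [Finset.sum_apply, Function.comp_apply]
    rw [← Finset.add_sum_erase _ _ ht]

/-- The joint cumulant of functions of single independent variables, not all of which are the
same, vanishes. -/
theorem jointCumulant_comp_eq_zero [Finite V] [IsProbabilityMeasure μ]
    (hm : ∀ v, Measurable (noise v)) (hind : iIndepFun noise μ) {k : ℕ} (g : Fin k → V)
    {ψ : Fin k → ℝ → ℝ} (hψ : ∀ j, Measurable (ψ j)) {i₀ i₁ : Fin k} (hg : g i₁ ≠ g i₀) :
    jointCumulant μ (fun j ω => ψ j (noise (g j) ω)) = 0 := by
  classical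
  have := Fintype.ofFinite V
  rw [jointCumulant_eq_setCumulant]
  refine setCumulant_eq_zero _ (by simp) (Finset.univ.filter fun j => g j = g i₀) ?_ _
    ⟨i₀, by simp⟩ ⟨i₁, by simpa using hg⟩
  intro S
  have h1 := hind.indepFun_finset {g i₀} (Finset.univ.erase (g i₀)) (by simp) hm
  -- The default `0` is never evaluated: below, the products run only over `j` with `g j ∈ T`.
  have ext_meas (T : Finset V) (j : Fin k) : Measurable
      fun x : T → ℝ => ψ j (if h : g j ∈ T then x ⟨g j, h⟩ else 0) := by
    by_cases h : g j ∈ T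
    · simp only [h, dif_pos]
      exact (hψ j).comp (measurable_pi_apply _)
    · simp only [h, dif_neg, not_false_eq_true]
      exact measurable_const
  have prod_meas (T : Finset V) (R : Finset (Fin k)) : Measurable
      fun x : T → ℝ => ∏ j ∈ R, ψ j (if h : g j ∈ T then x ⟨g j, h⟩ else 0) :=
    Finset.measurable_prod _ fun j _ => ext_meas T j
  have hpm (R : Finset (Fin k)) : Measurable fun ω => ∏ j ∈ R, ψ j (noise (g j) ω) :=
    Finset.measurable_prod _ fun j _ => (hψ j).comp (hm (g j))
  have h2 := h1.comp (prod_meas {g i₀} (S ∩ Finset.univ.filter fun j => g j = g i₀))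
    (prod_meas (Finset.univ.erase (g i₀)) (S \ Finset.univ.filter fun j => g j = g i₀))
  have h3 : IndepFun
      (fun ω => ∏ j ∈ S ∩ Finset.univ.filter fun j => g j = g i₀, ψ j (noise (g j) ω))
      (fun ω => ∏ j ∈ S \ Finset.univ.filter fun j => g j = g i₀, ψ j (noise (g j) ω)) μ := by
    refine h2.congr (Filter.Eventually.of_forall fun ω => ?_)
      (Filter.Eventually.of_forall fun ω => ?_)
    · refine Finset.prod_congr rfl fun j hj => ?_
      simp only [Finset.mem_inter, Finset.mem_filter, Finset.mem_univ, true_and] at hj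
      rw [dif_pos (Finset.mem_singleton.mpr hj.2)]
    · refine Finset.prod_congr rfl fun j hj => ?_
      simp only [Finset.mem_sdiff, Finset.mem_filter, Finset.mem_univ, true_and] at hj
      rw [dif_pos (Finset.mem_erase.mpr ⟨hj.2, Finset.mem_univ _⟩)]
  rw [← h3.integral_fun_mul_eq_mul_integral (hpm _).aestronglyMeasurable
    (hpm _).aestronglyMeasurable]
  simp only [Finset.prod_inter_mul_prod_sdiff]

variable (μ noise) in
/-- The random variables which are almost surely a sum of functions of the single noises
`noise t`, `t ∈ B`. -/
def noiseSums (B : Finset V) : Submodule ℝ (Ω → ℝ) where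
  carrier := {f | ∃ ψ : V → ℝ → ℝ, (∀ t, Measurable (ψ t)) ∧
    ∀ᵐ ω ∂μ, f ω = ∑ t ∈ B, ψ t (noise t ω)}
  add_mem' := by
    rintro f g ⟨ψ, hψ, hf⟩ ⟨χ, hχ, hg⟩
    refine ⟨fun t x => ψ t x + χ t x, fun t => (hψ t).add (hχ t), ?_⟩
    filter_upwards [hf, hg] with ω h1 h2
    rw [Pi.add_apply, h1, h2, Finset.sum_add_distrib]
  zero_mem' := ⟨fun _ _ => 0, fun _ => measurable_const, by simp⟩
  smul_mem' := by
    rintro c f ⟨ψ, hψ, hf⟩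
    refine ⟨fun t x => c * ψ t x, fun t => (hψ t).const_mul c, ?_⟩
    filter_upwards [hf] with ω h1
    rw [Pi.smul_apply, h1, smul_eq_mul, Finset.mul_sum]

/-- The joint cumulant of sums of functions of single independent noises vanishes if no noise is
common to all the sums. -/
theorem jointCumulant_eq_zero_of_noiseSums [Finite V] [IsProbabilityMeasure μ]
    (hm : ∀ v, Measurable (noise v)) (hind : iIndepFun noise μ) {k : ℕ} [NeZero k]
    (B : Fin k → Finset V) (hB : ∀ t, ∃ j, t ∉ B j) {Y : Fin k → Ω → ℝ}
    (hY : ∀ j, Y j ∈ noiseSums μ noise (B j)) (hL : ∀ j, MemLp (Y j) k μ) :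
    jointCumulant μ Y = 0 := by
  classical
  choose ψ hψ hψY using hY
  rw [jointCumulant_congr_ae hψY]
  -- Multilinear expansion needs each summand, and not only the sum, to lie in `L^k`.
  have hmem (j : Fin k) (t : B j) :
      (fun ω => ψ j t (noise t ω)) ∈ memLpSubmodule μ (k : ENNReal) :=
    memLp_summand_of_memLp_sum hm hind (hψ j) (NeZero.ne k)
      ((memLp_congr_ae (hψY j)).mp (hL j)) t.2
  have hsum := (cumulantMultilinear μ k).map_sum
    (g := fun (j : Fin k) (t : B j) => (⟨_, hmem j t⟩ : memLpSubmodule μ (k : ENNReal)))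
  have hl : (fun j ω => ∑ t ∈ B j, ψ j t (noise t ω)) = fun j =>
      ((∑ t : B j, (⟨_, hmem j t⟩ : memLpSubmodule μ (k : ENNReal)) :
        memLpSubmodule μ (k : ENNReal)) : Ω → ℝ) := by
    funext j ω
    rw [AddSubmonoidClass.coe_finsetSum, Finset.sum_apply, ← Finset.sum_coe_sort]
  rw [hl]
  refine hsum.trans (Finset.sum_eq_zero fun r _ => ?_)
  -- The noise chosen in slot `0` is missing from some `B i₁`, so slot `i₁` must use a different
  -- one.
  obtain ⟨i₁, hi₁⟩ := hB (r 0)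
  exact jointCumulant_comp_eq_zero hm hind (fun j => (r j : V))
    (ψ := fun j => ψ j (r j)) (fun j => hψ j _) (i₀ := 0) (i₁ := i₁)
    fun h => hi₁ (h ▸ (r i₁).2)

end Independence

/-! ### Rank bound from independent relations. -/

section LinearAlgebra

/-- If the columns `v ∈ B` of an invertible matrix are supported in `A ∪ B` and give relations
modulo `W` between the vectors `x u`, then these vectors with `u ∈ A ∪ B` are modulo `W` linear
combinations of at most `|A|` vectors. -/
theorem exists_linear_combination_of_isUnit {V E : Type*} [Fintype V] [DecidableEq V]
    [AddCommGroup E] [Module ℝ E] (W : Submodule ℝ E) (x : V → E) {N : Matrix V V ℝ}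
    (hN : IsUnit N) {A B : Finset V} (hAB : Disjoint A B)
    (hsupp : ∀ v ∈ B, ∀ u, u ∉ A ∪ B → N u v = 0)
    (hrel : ∀ v ∈ B, ∑ u, N u v • x u ∈ W) :
    ∃ d ≤ A.card, ∃ (Z : Fin d → E) (c : V → Fin d → ℝ),
      ∀ u ∈ A ∪ B, x u - ∑ r, c u r • Z r ∈ W := by
  let Φ : (↥(A ∪ B) → ℝ) →ₗ[ℝ] E ⧸ W := Fintype.linearCombination ℝ fun u => W.mkQ (x u)
  have hΦ (a : ↥(A ∪ B) → ℝ) : Φ a = W.mkQ (∑ u, a u • x u) := by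
    simp [Φ, Fintype.linearCombination_apply]
  let col : B → ↥(A ∪ B) → ℝ := fun v u => N u v
  have hcol (v : B) : col v ∈ LinearMap.ker Φ := by
    rw [LinearMap.mem_ker, hΦ, Submodule.mkQ_apply, Submodule.Quotient.mk_eq_zero]
    have h : ∑ u : ↥(A ∪ B), col v u • x u = ∑ u, N u v • x u := by
      rw [Finset.sum_coe_sort (A ∪ B) fun u => N u v • x u]
      refine Finset.sum_subset (Finset.subset_univ _) fun u _ hu => ?_
      rw [hsupp v v.2 u hu, zero_smul]
    rw [h]
    exact hrel v v.2
  -- By the support condition, extending `col v` by zero recovers the full column of `N`.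
  have hli : LinearIndependent ℝ col := by
    refine LinearIndependent.of_comp
      (Function.ExtendByZero.linearMap ℝ (Subtype.val : ↥(A ∪ B) → V)) ?_
    have h := (Matrix.linearIndependent_cols_of_isUnit hN).comp (Subtype.val : B → V)
      Subtype.val_injective
    have heq : ⇑(Function.ExtendByZero.linearMap ℝ (Subtype.val : ↥(A ∪ B) → V)) ∘ col =
        N.col ∘ (Subtype.val : B → V) := by
      funext v u
      by_cases hu : u ∈ A ∪ B
      · exact Subtype.val_injective.extend_apply (col v) (0 : V → ℝ) (⟨u, hu⟩ : ↥(A ∪ B))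
      · refine (Function.extend_apply' (col v) (0 : V → ℝ) u ?_).trans (hsupp v v.2 u hu).symm
        rintro ⟨w, rfl⟩
        exact hu w.2
    rw [heq]
    exact h
  have hker : B.card ≤ Module.finrank ℝ (LinearMap.ker Φ) := by
    have h : LinearIndependent ℝ fun v => (⟨col v, hcol v⟩ : LinearMap.ker Φ) :=
      LinearIndependent.of_comp (LinearMap.ker Φ).subtype hli
    simpa using h.fintype_card_le_finrank
  have hrank := LinearMap.finrank_range_add_finrank_ker Φ
  rw [Module.finrank_fintype_fun_eq_card, Fintype.card_coe,
    Finset.card_union_of_disjoint hAB] at hrank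
  let b := Module.finBasis ℝ (LinearMap.range Φ)
  -- A basis of the range of `Φ` is lifted to actual combinations of the `x u`. Rank-nullity bounds
  -- its size by `|A|`.
  choose a ha using fun r => (b r).2
  refine ⟨Module.finrank ℝ (LinearMap.range Φ), by lia, fun r => ∑ u, a r u • x u, fun u r =>
    if hu : u ∈ A ∪ B then b.repr ⟨Φ (Pi.single ⟨u, hu⟩ 1), LinearMap.mem_range_self _ _⟩ r else 0,
    fun u hu => ?_⟩
  simp only [hu, dif_pos]
  rw [← Submodule.Quotient.mk_eq_zero, ← Submodule.mkQ_apply, map_sub, map_sum, sub_eq_zero]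
  simp only [map_smul]
  have h1 : W.mkQ (x u) = Φ (Pi.single ⟨u, hu⟩ 1) := by
    simp [hΦ, Pi.single_apply, ite_smul]
  have h2 := congrArg Subtype.val
    (b.sum_repr ⟨Φ (Pi.single ⟨u, hu⟩ 1), LinearMap.mem_range_self _ _⟩)
  simp only [AddSubmonoidClass.coe_finsetSum, SetLike.val_smul] at h2
  refine (h1.trans h2.symm).trans (Finset.sum_congr rfl fun r _ => ?_)
  exact congrArg _ ((ha r).symm.trans (hΦ _))

end LinearAlgebra

/-! ### Directed paths avoiding the choke sets. -/

section Paths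

variable {V : Type*} {G : Digraph V}

theorem isDiPath_singleton (v : V) : IsDiPath G [v] v v := by
  simp [IsDiPath]

theorem IsDiPath.append {l l' : List V} {w u v s : V} (h : IsDiPath G l w u) (huv : G.Adj u v)
    (h' : IsDiPath G l' v s) : IsDiPath G (l ++ l') w s := by
  obtain ⟨h1, h2, h3⟩ := h
  obtain ⟨h1', h2', h3'⟩ := h'
  refine ⟨List.isChain_append.mpr ⟨h1, h1', ?_⟩, ?_, ?_⟩
  · intro x hx y hy
    rw [h3, Option.mem_some_iff] at hx
    rw [h2', Option.mem_some_iff] at hy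
    rwa [← hx, ← hy]
  · rw [List.head?_append, h2, Option.some_or]
  · rw [List.getLast?_append, h3', Option.some_or]

theorem IsDiPath.infix_append {l l' : List V} {w u v s : V} (h : IsDiPath G l w u)
    (h' : IsDiPath G l' v s) : [u, v] <:+: l ++ l' := by
  obtain ⟨l₁, rfl⟩ := List.getLast?_eq_some_iff.mp h.2.2
  obtain ⟨l₂, rfl⟩ := List.head?_eq_some_iff.mp h'.2.1
  exact ⟨l₁, l₂, by simp⟩

theorem IsDiPath.exists_suffix {l : List V} {w u a : V} (h : IsDiPath G l w u) (ha : a ∈ l) :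
    ∃ l', IsDiPath G l' a u := by
  obtain ⟨l₁, l₂, rfl⟩ := List.append_of_mem ha
  refine ⟨a :: l₂, (List.isChain_append.mp h.1).2.1, rfl, ?_⟩
  have := h.2.2
  rw [List.getLast?_append] at this
  rw [List.getLast?_cons] at this ⊢
  simpa using this

theorem IsDiPath.head_mem {l : List V} {u v : V} (h : IsDiPath G l u v) : u ∈ l :=
  List.mem_of_head? h.2.1

theorem adj_of_isEdgeUnder {k : ℕ} {A S : Fin k → Finset V} {u v : V}
    (h : IsEdgeUnder G A S u v) : G.Adj u v := by
  obtain ⟨j, a, -, s, -, l, hl, huv⟩ := h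
  have := hl.1.infix huv
  simpa using this

variable [Fintype V]

variable (G) in
open Classical in
/-- The vertices from which there is a directed path to `S` that avoids `A`. -/
noncomputable def reachAvoiding (A S : Finset V) : Finset V :=
  Finset.univ.filter fun v => ∃ s ∈ S, ∃ l, IsDiPath G l v s ∧ ∀ x ∈ l, x ∉ A

theorem mem_reachAvoiding {A S : Finset V} {v : V} :
    v ∈ reachAvoiding G A S ↔ ∃ s ∈ S, ∃ l, IsDiPath G l v s ∧ ∀ x ∈ l, x ∉ A := by
  simp [reachAvoiding]

theorem mem_ancestors {u w : V} : w ∈ ancestors G u ↔ ∃ l, IsDiPath G l w u := by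
  simp [ancestors]

theorem disjoint_reachAvoiding (A S : Finset V) : Disjoint A (reachAvoiding G A S) := by
  rw [Finset.disjoint_right]
  intro v hv
  obtain ⟨s, -, l, hl, hA⟩ := mem_reachAvoiding.mp hv
  exact hA v hl.head_mem

theorem mem_union_reachAvoiding_of_mem [DecidableEq V] {A S : Finset V} {s : V} (hs : s ∈ S) :
    s ∈ A ∪ reachAvoiding G A S := by
  by_cases h : s ∈ A
  · exact Finset.mem_union_left _ h
  · exact Finset.mem_union_right _
      (mem_reachAvoiding.mpr ⟨s, hs, [s], isDiPath_singleton s, by simpa using h⟩)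

theorem mem_union_reachAvoiding_of_adj [DecidableEq V] {A S : Finset V} {u v : V}
    (hv : v ∈ reachAvoiding G A S) (huv : G.Adj u v) : u ∈ A ∪ reachAvoiding G A S := by
  by_cases h : u ∈ A
  · exact Finset.mem_union_left _ h
  · obtain ⟨s, hs, l, hl, hA⟩ := mem_reachAvoiding.mp hv
    refine Finset.mem_union_right _ (mem_reachAvoiding.mpr
      ⟨s, hs, [u] ++ l, (isDiPath_singleton u).append huv hl, ?_⟩)
    simpa [h] using hA

/-- If a path to `u` met `A j` at `x`, its tail from `x`, followed by `u → v` and a path to `S j`,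
would put this edge under `A j`. -/
theorem ancestors_subset_reachAvoiding {k : ℕ} {A S : Fin k → Finset V} {j : Fin k} {u v : V}
    (hv : v ∈ reachAvoiding G (A j) (S j)) (huv : G.Adj u v) (hlin : ¬ IsEdgeUnder G A S u v) :
    ancestors G u ⊆ reachAvoiding G (A j) (S j) := by
  obtain ⟨s, hs, l, hl, hA⟩ := mem_reachAvoiding.mp hv
  intro w hw
  obtain ⟨p, hp⟩ := mem_ancestors.mp hw
  refine mem_reachAvoiding.mpr ⟨s, hs, p ++ l, hp.append huv hl, fun x hx => ?_⟩
  rcases List.mem_append.mp hx with hx | hx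
  · intro hxA
    obtain ⟨q, hq⟩ := hp.exists_suffix hx
    exact hlin ⟨j, x, hxA, s, hs, q ++ l, hq.append huv hl, hq.infix_append hl⟩
  · exact hA x hx

theorem KTrekSeparates.exists_notMem_reachAvoiding {k : ℕ} {A S : Fin k → Finset V}
    (h : KTrekSeparates G A S) (t : V) : ∃ j, t ∉ reachAvoiding G (A j) (S j) := by
  by_contra! hall
  choose s hs l hl hA using fun j => mem_reachAvoiding.mp (hall j)
  obtain ⟨j, a, ha, haA⟩ := h t s l hs hl
  exact hA j a ha haA

end Paths

/-! ### The model as a linear system modulo noise sums. -/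

section NoiseSums

variable {V Ω : Type*} [MeasurableSpace Ω] {μ : Measure Ω} {noise : V → Ω → ℝ}

theorem mem_noiseSums_congr {B : Finset V} {f g : Ω → ℝ} (h : f =ᵐ[μ] g)
    (hg : g ∈ noiseSums μ noise B) : f ∈ noiseSums μ noise B := by
  obtain ⟨ψ, hψ, h'⟩ := hg
  exact ⟨ψ, hψ, h.trans h'⟩

theorem comp_noise_mem_noiseSums {B : Finset V} {v : V} (hv : v ∈ B) {χ : ℝ → ℝ}
    (hχ : Measurable χ) : (fun ω => χ (noise v ω)) ∈ noiseSums μ noise B := by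
  classical
  refine ⟨Pi.single v χ, fun t => ?_, Filter.Eventually.of_forall fun ω => ?_⟩
  · rcases eq_or_ne t v with rfl | h
    · simpa using hχ
    · rw [Pi.single_eq_of_ne h]
      exact measurable_const
  · dsimp only
    rw [Finset.sum_eq_single_of_mem v hv, Pi.single_eq_same]
    intro t _ ht
    simp [ht]

theorem sum_comp_noise_mem_noiseSums {B C : Finset V} (hC : C ⊆ B) {χ : V → ℝ → ℝ}
    (hχ : ∀ t, Measurable (χ t)) :
    (fun ω => ∑ t ∈ C, χ t (noise t ω)) ∈ noiseSums μ noise B := by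
  have h := (noiseSums μ noise B).sum_mem fun t ht =>
    comp_noise_mem_noiseSums (μ := μ) (noise := noise) (hC ht) (hχ t)
  rwa [Finset.sum_fn] at h

variable [Fintype V] {G : Digraph V}

/-- On the vertices with a path to `S j` avoiding `A j` the model is a linear system modulo
functions of the noises of these vertices. -/
theorem IsLinearUnder.sum_mem_noiseSums [DecidableEq V] {M : RecursivelyAdditiveModel G μ} {k : ℕ}
    {A S : Fin k → Finset V} {L : Matrix V V ℝ} (hlin : IsLinearUnder M A S L) {j : Fin k} {v : V}
    (hv : v ∈ reachAvoiding G (A j) (S j)) :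
    ∑ u, (1 - L) u v • M.X u ∈ noiseSums μ M.noise (reachAvoiding G (A j) (S j)) := by
  have hpar (u : V) : u ∈ parents G v ↔ G.Adj u v := by simp [parents]
  have hedge : ∀ u ∈ parents G v, (fun ω => M.coef u v * M.f u v (M.X u ω) - L u v * M.X u ω) ∈
      noiseSums μ M.noise (reachAvoiding G (A j) (S j)) := by
    intro u hu
    rw [hpar] at hu
    by_cases he : IsEdgeUnder G A S u v
    · obtain ⟨d, hd⟩ := hlin.linear u v he
      refine mem_noiseSums_congr ?_
        (comp_noise_mem_noiseSums (χ := fun _ => d) hv measurable_const)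
      filter_upwards [hd] with ω hω
      rw [hω, add_sub_cancel_left]
    · obtain ⟨φ, hφ, hX, w, hw, hf⟩ := M.additive u v hu
      refine mem_noiseSums_congr ?_ (sum_comp_noise_mem_noiseSums
        (ancestors_subset_reachAvoiding hv hu he)
        (χ := fun t x => M.coef u v * w t (φ t x))
        fun t => ((hw t).comp (hφ t)).const_mul _)
      filter_upwards [hX, hf] with ω h1 h2
      rw [hlin.zero u v he, zero_mul, sub_zero, h1, h2, Finset.mul_sum]
  have hsum := (noiseSums μ M.noise (reachAvoiding G (A j) (S j))).add_mem
    (Submodule.sum_mem _ hedge) (comp_noise_mem_noiseSums hv measurable_id)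
  refine mem_noiseSums_congr ?_ hsum
  filter_upwards [M.structural_eq v] with ω hω
  have hL : ∑ u, L u v * M.X u ω = ∑ u ∈ parents G v, L u v * M.X u ω := by
    refine (Finset.sum_subset (Finset.subset_univ _) fun u _ hu => ?_).symm
    rw [hlin.zero u v fun h => hu ((hpar u).mpr (adj_of_isEdgeUnder h)), zero_mul]
  have h1 : ∑ u, (1 : Matrix V V ℝ) u v * M.X u ω = M.X v ω := by
    simp [Matrix.one_apply]
  simp only [Finset.sum_apply, Pi.add_apply, Pi.smul_apply, smul_eq_mul, Matrix.sub_apply,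
    sub_mul, Finset.sum_sub_distrib, id]
  rw [h1, hL, hω]
  ring

end NoiseSums

/-! ### Slice decomposition of the cumulant tensor and conclusion. -/

/-- Replacing the arguments of a multilinear map by their values modulo linear combinations of few
vectors changes it by a sum of terms each of which depends linearly on one of the coefficients. -/
theorem MultilinearMap.map_sub_map_of_linear_combination {E : Type*} [AddCommGroup E] [Module ℝ E]
    {k : ℕ} (F : MultilinearMap ℝ (fun _ : Fin k => E) ℝ) (d : Fin k → ℕ)
    (Z : (j : Fin k) → Fin (d j) → E) (c : (j : Fin k) → Fin (d j) → ℝ) (x y : Fin k → E)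
    (h : ∀ j, x j - y j = ∑ r, c j r • Z j r) :
    F x - F y = ∑ ρ : Σ j, Fin (d j), c ρ.1 ρ.2 *
      F fun l => if l < ρ.1 then x l else if l = ρ.1 then Z ρ.1 ρ.2 else y l := by
  -- Telescoping: in the `j`-th difference the slots before `j` hold `x`, those after it hold `y`,
  -- and slot `j` holds `x j - y j`.
  have hF := F.map_piecewise_sub_map_piecewise x y x Finset.univ
  simp only [Finset.piecewise_univ, Finset.mem_univ, if_true] at hF
  rw [hF, Fintype.sum_sigma]
  refine Finset.sum_congr rfl fun j _ => ?_
  have hupd (z : E) : (fun l => if l < j then x l else if l = j then z else y l) =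
      Function.update (fun l => if l < j then x l else y l) j z := by
    funext l
    rcases eq_or_ne l j with rfl | hl
    · simp
    · simp [hl]
  have hz : (fun l => if l < j then x l else if l = j then x l - y l else y l) =
      fun l => if l < j then x l else if l = j then ∑ r, c j r • Z j r else y l := by
    funext l
    rcases eq_or_ne l j with rfl | hl
    · simp [h]
    · simp [hl]
  rw [hz, hupd, F.map_update_sum]
  refine Finset.sum_congr rfl fun r _ => ?_
  rw [F.map_update_smul, smul_eq_mul, hupd]

theorem mainTheorem6 {V Ω : Type*} [Fintype V] [DecidableEq V] [MeasurableSpace Ω]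
    (μ : Measure Ω) [IsProbabilityMeasure μ] (G : Digraph V) (M : RecursivelyAdditiveModel G μ)
    (k n : ℕ) [NeZero k] (hmom : ∀ v, MemLp (M.X v) k μ)
    (S A : Fin k → Finset V) (e : (j : Fin k) → Fin n ≃ S j)
    (L : Matrix V V ℝ) (hlin : IsLinearUnder M A S L) (hinv : IsUnit (1 - L))
    (hsep : KTrekSeparates G A S)
    (hparity : Even k ∨ A 0 = ∅)
    (hcard : ∑ j, (A j).card < n) :
    combinatorialHyperdet
      (fun i : Fin k → Fin n => jointCumulant μ fun j => M.X (e j (i j))) = 0 := by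
  -- Doing the linear algebra inside `L^k` guarantees that the `Z j r` and the remainders `y j v`
  -- have the moments that cumulants require.
  let x (v : V) : memLpSubmodule μ (k : ENNReal) := ⟨M.X v, hmom v⟩
  have hdec (j : Fin k) := exists_linear_combination_of_isUnit
    ((noiseSums μ M.noise (reachAvoiding G (A j) (S j))).comap
      (memLpSubmodule μ (k : ENNReal)).subtype) x hinv (disjoint_reachAvoiding (A j) (S j))
    (fun v hv u hu => by
      have huv : ¬ G.Adj u v := fun h => hu (mem_union_reachAvoiding_of_adj hv h)
      have hne : u ≠ v := by
        rintro rfl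
        exact hu (Finset.mem_union_right _ hv)
      rw [Matrix.sub_apply, Matrix.one_apply_ne hne,
        hlin.zero u v fun h => huv (adj_of_isEdgeUnder h), sub_zero])
    (fun v hv => by simpa [x] using hlin.sum_mem_noiseSums hv)
  choose d hd Z c hc using hdec
  let y (j : Fin k) (v : V) : memLpSubmodule μ (k : ENNReal) := x v - ∑ r, c j v r • Z j r
  have hy (i : Fin k → Fin n) :
      cumulantMultilinear μ k (fun j => y j (e j (i j))) = 0 :=
    jointCumulant_eq_zero_of_noiseSums M.measurable_noise M.indep_noise
      (fun j => reachAvoiding G (A j) (S j)) hsep.exists_notMem_reachAvoiding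
      (fun j => hc j _ (mem_union_reachAvoiding_of_mem (e j (i j)).2))
      fun j => (y j (e j (i j))).2
  have hT : (fun i : Fin k → Fin n => jointCumulant μ fun j => M.X (e j (i j))) =
      fun i => ∑ ρ : Σ j, Fin (d j), c ρ.1 (e ρ.1 (i ρ.1)) ρ.2 *
        cumulantMultilinear μ k fun l => if l < ρ.1 then x (e l (i l)) else
          if l = ρ.1 then Z ρ.1 ρ.2 else y l (e l (i l)) := by
    funext i
    rw [← (cumulantMultilinear μ k).map_sub_map_of_linear_combination d Z
      (fun j => c j (e j (i j))) (fun j => x (e j (i j))) (fun j => y j (e j (i j)))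
      fun j => sub_sub_cancel _ _, hy, sub_zero]
    rfl
  rw [hT]
  refine combinatorialHyperdet_eq_zero_of_slices (ι := Σ j, Fin (d j)) ?_ Sigma.fst ?_
    (fun ρ a => c ρ.1 (e ρ.1 a) ρ.2) _ ?_
  · simp only [Fintype.card_sigma, Fintype.card_fin]
    exact (Finset.sum_le_sum fun j _ => hd j).trans_lt hcard
  -- If `A 0` is empty then `d 0 = 0`, so no slice is taken along axis `0`.
  · refine hparity.imp_right fun h0 => ?_
    rintro ⟨j, r⟩ rfl
    have h := hd 0
    rw [h0, Finset.card_empty] at h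
    exact absurd r.2 (by lia)
  -- Slot `ρ.1` holds the fixed variable `Z ρ.1 ρ.2`, so the cofactor ignores that index.
  · intro ρ i a
    congr 1
    funext l
    by_cases hl : l = ρ.1
    · simp [hl]
    · rw [Function.update_of_ne hl]
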